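/- Let $r,d\in\mathbb N$ (so $r,d\ge 1$), $1\le p<\infty$, $Q=[0,1]^d$, and let $W_p^r(Q)$ be the Sobolev space with norm $\big(\sum_{|\alpha|\le r}\|D^\alpha f\|_{L_p}^p\big)^{1/p}$. Assume that the embedding condition $$(p=1\ \text{and}\ r/d\ge 1)\quad\text{or}\quad(1<p<\infty\ \text{and}\ r/d>1/p)$$ (under which $W_p^r(Q)$ embeds into $C(Q)$) does not hold. Consider the problem $\mathcal P_1=(F_1,\mathbb R,I_1,\mathbb R,\Lambda_1)$, where $F_1=B_{W_p^r(Q)}\cap C(Q)$ is the set of continuous elements of the closed unit ball of $W_p^r(Q)$, $I_1f=\int_Q f(x)\,dx$ is the solution operator, and $\Lambda_1=\{\delta_x: x\in Q\}$, $\delta_x(f)=f(x)$, is the set of information functionals. An access restriction $\mathcal R=((\Omega,\Sigma,\mathbb P),K',\Lambda')$ consists of a probability space, a non-empty set $K'$ and a non-empty set $\Lambda'$ of mappings $\Omega\to K'$; it is finite if $K'$ is finite and $\lambda'^{-1}(\{u\})\in\Sigma$ for all $\lambda'\in\Lambda'$, $u\in K'$. An $\mathcal R$-restricted randomized algorithm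 $A$ for $\mathcal P_1$ successively calls functionals $\lambda_1,\lambda_2,\dots$ from the disjoint union $\Lambda_1\,\dot\cup\,\Lambda'$, where $\lambda_{i+1}$ is an arbitrary function of the values (in $\mathbb R\,\dot\cup\,K'$) of $\lambda_1,\dots,\lambda_i$ at $(f,\omega)$, the elements of $\Lambda_1$ being applied to $f$ and those of $\Lambda'$ to $\omega$. After each $i\ge 0$ calls an arbitrary function of the values obtained so far decides whether to stop, and when $A$ stops its output $A(f,\omega)$ is an arbitrary real function of these values (if $A$ never stops, the output is a fixed default value). Let $\mathrm{card}_{\Lambda_1}(A,f,\omega)$ and $\mathrm{card}_{\Lambda'}(A,f,\omega)$ in $\mathbb N_0\cup\{\infty\}$ be the numbers of calls of functionals from $\Lambda_1$ and from $\Lambda'$. For $n,k\in\mathbb N_0$ let $$e^{\rm ran}_{n,k}(\mathcal P_1,\mathcal R)=\inf_A\ \sup_{f\in F_1}\mathbb E\,|I_1f-A(f,\omega)|,$$ where the infimum is over all such $A$ for which these cardinalities and the output are measurable in $\omega$ for every $f\in F_1$, and $\mathbb E\,\mathrm{card}_{\Lambda_1}(A,f,\omega)\le n$ and $\mathbb E\,\mathrm{card}_{\Lambda'}(A,f,\omega)\le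 k$ for every $f\in F_1$. Then for every finite access restriction $\mathcal R$ there is a constant $c>0$ such that for all $n,k\in\mathbb N_0$ $$e^{\rm ran}_{n,k}(\mathcal P_1,\mathcal R)\ge c.$$ -/

import Mathlib

open MeasureTheory Set
open scoped ENNReal

noncomputable section

namespace RestrictedMC

/-! Abstract numerical problems and restricted randomized algorithms -/

/-- An abstract numerical problem `(F, G, S, K, Λ)`: a non-empty set `F` of inputs, a Banach space
`G`, a solution operator `S : F → G`, a non-empty set `K`, and a non-empty set `Λ` of information
functionals `F → K`. -/
structure Problem (F G K : Type*) where
  /-- the solution operator -/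
  S : F → G
  /-- the set of information functionals -/
  Λ : Set (F → K)
  nonempty_F : Nonempty F
  nonempty_K : Nonempty K
  nonempty_Λ : Λ.Nonempty

/-- A probability space with access restriction `((Ω, Σ, ℙ), K', Λ')`. -/
structure AccessRestriction (Ω K' : Type*) [MeasurableSpace Ω] where
  /-- the probability measure -/
  ℙ : Measure Ω
  isProb : IsProbabilityMeasure ℙ
  /-- the set of functionals through which the randomness can be accessed -/
  Λ' : Set (Ω → K')
  nonempty_K' : Nonempty K'
  nonempty_Λ' : Λ'.Nonempty

/-- The access restriction is finite: `K'` is finite and `λ'⁻¹({u}) ∈ Σ` for all `λ' ∈ Λ'`,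
`u ∈ K'`. -/
def AccessRestriction.IsFinite {Ω K' : Type*} [MeasurableSpace Ω]
    (R : AccessRestriction Ω K') : Prop :=
  Finite K' ∧ ∀ l ∈ R.Λ', ∀ u : K', MeasurableSet (l ⁻¹' {u})

section Algorithms

variable {F G K Ω K' : Type*} [MeasurableSpace Ω]

/-- An `R`-restricted randomized algorithm for `P`. The disjoint unions are `K ⊕ K'` and
`Λ ⊕ Λ'`. A sequence of mappings, one on the `i`-tuples of `K ⊕ K'` for every `i ≥ 0`, is
the same as one mapping on the finite lists over `K ⊕ K'`. On lists of length `i`, `L` is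
`L_{i+1}`, `τ` is `τ_i` and `φ` is `φ_i` (the value `true` stands for `1`). -/
structure Algorithm (P : Problem F G K) (R : AccessRestriction Ω K') where
  /-- choice of the next functional, given the values obtained so far -/
  L : List (K ⊕ K') → P.Λ ⊕ R.Λ'
  /-- the stopping rule -/
  τ : List (K ⊕ K') → Bool
  /-- the output maps -/
  φ : List (K ⊕ K') → G

variable {P : Problem F G K} {R : AccessRestriction Ω K'}

/-- The value `λ(f, ω)` of a functional `λ ∈ Λ ⊕ Λ'`. -/
def answer (l : P.Λ ⊕ R.Λ') (f : F) (ω : Ω) : K ⊕ K' :=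
  match l with
  | Sum.inl l => Sum.inl (l.1 f)
  | Sum.inr l => Sum.inr (l.1 ω)

namespace Algorithm

variable (A : Algorithm P R)

/-- The list `[λ_1(f, ω), …, λ_n(f, ω)]`. -/
def history (f : F) (ω : Ω) : ℕ → List (K ⊕ K')
  | 0 => []
  | n + 1 => history f ω n ++ [answer (A.L (history f ω n)) f ω]

/-- `query f ω n` is the functional `λ_{n+1}` used at the input `(f, ω)`. -/
def query (f : F) (ω : Ω) (n : ℕ) : P.Λ ⊕ R.Λ' := A.L (A.history f ω n)

/-- The total cardinality: the first `n ≥ 0` with `τ_n = 1`, and `∞` if there is none. -/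
def card (f : F) (ω : Ω) : ℕ∞ :=
  ⨅ (n : ℕ) (_ : A.τ (A.history f ω n) = true), (n : ℕ∞)

/-- The number of information functionals from `Λ` that are called. -/
def cardInfo (f : F) (ω : Ω) : ℕ∞ :=
  {n : ℕ | (n : ℕ∞) < A.card f ω ∧ (A.query f ω n).isLeft = true}.encard

/-- The number of random functionals from `Λ'` that are called. -/
def cardRand (f : F) (ω : Ω) : ℕ∞ :=
  {n : ℕ | (n : ℕ∞) < A.card f ω ∧ (A.query f ω n).isRight = true}.encard

/-- The output: `φ_n(λ_1(f, ω), …, λ_n(f, ω))` if the cardinality is `n < ∞`, and `φ_0` if the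
cardinality is `∞` (as `ENat.toNat ⊤ = 0`). -/
def output (f : F) (ω : Ω) : G := A.φ (A.history f ω (A.card f ω).toNat)

/-- The class of measurable algorithms: for each input the cardinalities are measurable, and the
output is Borel measurable and almost surely separably valued. -/
structure IsMeas [NormedAddCommGroup G] [NormedSpace ℝ G] : Prop where
  measurable_cardInfo : ∀ f, Measurable (A.cardInfo f)
  measurable_cardRand : ∀ f, Measurable (A.cardRand f)
  measurable_output : ∀ f, Measurable[_, borel G] (A.output f)
  separable_output : ∀ f, ∃ T : Submodule ℝ G,
    TopologicalSpace.IsSeparable (T : Set G) ∧ ∀ᵐ ω ∂(R.ℙ), A.output f ω ∈ T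

/-- The error `sup_f 𝔼 ‖S f - A(f, ω)‖`, with values in `[0, ∞]`. -/
def error [NormedAddCommGroup G] : ℝ≥0∞ :=
  ⨆ f : F, ∫⁻ ω, ‖P.S f - A.output f ω‖ₑ ∂(R.ℙ)

/-- The class of measurable algorithms with `𝔼 card_Λ ≤ n` and `𝔼 card_Λ' ≤ k` for all
inputs. -/
structure IsAdmissible [NormedAddCommGroup G] [NormedSpace ℝ G] (n k : ℕ) : Prop where
  isMeas : A.IsMeas
  cardInfo_le : ∀ f, ∫⁻ ω, (A.cardInfo f ω : ℝ≥0∞) ∂(R.ℙ) ≤ n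
  cardRand_le : ∀ f, ∫⁻ ω, (A.cardRand f ω : ℝ≥0∞) ∂(R.ℙ) ≤ k

end Algorithm

/-- The `(n, k)`-th minimal `R`-restricted randomized error of the problem `P`. -/
def minRanError [NormedAddCommGroup G] [NormedSpace ℝ G] [CompleteSpace G]
    (P : Problem F G K) (R : AccessRestriction Ω K') (n k : ℕ) : ℝ≥0∞ :=
  ⨅ (A : Algorithm P R) (_ : A.IsAdmissible n k), A.error

end Algorithms

/-! Sobolev spaces -/

/-- The cube `Q = [0,1]^d`. -/
abbrev cube (d : ℕ) : Set (Fin d → ℝ) := Set.Icc 0 1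

/-- The first order partial derivative in the direction of the `i`-th coordinate. -/
def partialDeriv {d : ℕ} (i : Fin d) (g : (Fin d → ℝ) → ℝ) : (Fin d → ℝ) → ℝ :=
  fun x => fderiv ℝ g x (Pi.single i 1)

/-- The classical partial derivative `D^α g` of a smooth function, for a multi-index `α`. -/
def multiDeriv {d : ℕ} (α : Fin d → ℕ) (g : (Fin d → ℝ) → ℝ) : (Fin d → ℝ) → ℝ :=
  (List.finRange d).foldr (fun i h => (partialDeriv i)^[α i] h) g

/-- `v` is the weak derivative `D^α u` of `u` on the open set `U`. -/
structure HasWeakDeriv {d : ℕ} (U : Set (Fin d → ℝ)) (α : Fin d → ℕ)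
    (u v : (Fin d → ℝ) → ℝ) : Prop where
  locInt_left : LocallyIntegrableOn u U
  locInt_right : LocallyIntegrableOn v U
  integral_eq : ∀ φ : (Fin d → ℝ) → ℝ, ContDiff ℝ ((⊤ : ℕ∞) : WithTop ℕ∞) φ →
    HasCompactSupport φ → tsupport φ ⊆ U →
    ∫ x in U, u x * multiDeriv α φ x = (-1) ^ (∑ i, α i) * ∫ x in U, v x * φ x

/-- The finite set of multi-indices `α` of order `|α| ≤ r`. -/
def multiIndices (d r : ℕ) : Finset (Fin d → ℕ) :=
  (Fintype.piFinset fun _ : Fin d => Finset.range (r + 1)).filter fun α => ∑ i, α i ≤ r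

theorem mem_multiIndices {d r : ℕ} {α : Fin d → ℕ} : α ∈ multiIndices d r ↔ ∑ i, α i ≤ r := by
  simp only [multiIndices, Finset.mem_filter, Fintype.mem_piFinset, Finset.mem_range,
    and_iff_right_iff_imp]
  intro h i
  have := Finset.single_le_sum (f := α) (fun j _ => Nat.zero_le _) (Finset.mem_univ i)
  omega

/-- The Sobolev norm `(∑_{|α| ≤ r} ‖D^α u‖_p^p)^(1/p)` on the open set `U`, with values in
`[0, ∞]`; it is `∞` if one of the weak derivatives of order at most `r` does not exist. (Weak
derivatives are unique almost everywhere, so that the infimum is over one value at most.) -/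
def sobolevENorm {d : ℕ} (r : ℕ) (p : ℝ) (U : Set (Fin d → ℝ)) (u : (Fin d → ℝ) → ℝ) : ℝ≥0∞ :=
  ⨅ (v : (Fin d → ℕ) → (Fin d → ℝ) → ℝ) (_ : ∀ α ∈ multiIndices d r, HasWeakDeriv U α u (v α)),
    (∑ α ∈ multiIndices d r, eLpNorm (v α) (ENNReal.ofReal p) (volume.restrict U) ^ p) ^ (1 / p)

open scoped Classical in
/-- Extension by zero of a function on the cube. -/
def extendZero {d : ℕ} (f : C(cube d, ℝ)) : (Fin d → ℝ) → ℝ :=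
  fun x => if h : x ∈ cube d then f ⟨x, h⟩ else 0

/-- The set of continuous elements of the unit ball of `W_p^r(Q)`; every equivalence class is
represented by its unique representative that is continuous on `Q`. -/
def sobolevBall (r d : ℕ) (p : ℝ) : Set C(cube d, ℝ) :=
  {f | sobolevENorm r p (interior (cube d)) (extendZero f) ≤ 1}

theorem zero_mem_sobolevBall (r d : ℕ) {p : ℝ} (hp : 1 ≤ p) : 0 ∈ sobolevBall r d p := by
  have h0 : extendZero (0 : C(cube d, ℝ)) = 0 := by
    funext x
    simp [extendZero]
  have hw : ∀ α ∈ multiIndices d r, HasWeakDeriv (interior (cube d)) α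
      (0 : (Fin d → ℝ) → ℝ) ((fun _ => 0) α) := fun α _ =>
    ⟨(locallyIntegrable_zero).locallyIntegrableOn _,
      (locallyIntegrable_zero).locallyIntegrableOn _, fun φ _ _ _ => by simp⟩
  rw [sobolevBall, mem_ofPred_eq, h0]
  refine (iInf₂_le (fun _ => 0) hw).trans ?_
  have hp' : 0 < p := by linarith
  simp [hp']

/-- The condition under which `W_p^r([0,1]^d)` is embedded into `C([0,1]^d)`. -/
def EmbeddingCondition (r d : ℕ) (p : ℝ) : Prop :=
  (p = 1 ∧ 1 ≤ (r : ℝ) / d) ∨ (1 < p ∧ 1 / p < (r : ℝ) / d)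

/-- The problem of integrating the continuous elements of the unit ball of `W_p^r([0,1]^d)`, with
the point evaluations at all points of the cube as information functionals. -/
def sobolevIntegration (r d : ℕ) (p : ℝ) (hp : 1 ≤ p) : Problem (sobolevBall r d p) ℝ ℝ where
  S f := ∫ x in cube d, extendZero f.1 x
  Λ := Set.range fun (x : cube d) (f : sobolevBall r d p) => f.1 x
  nonempty_F := ⟨⟨0, zero_mem_sobolevBall r d hp⟩⟩
  nonempty_K := ⟨0⟩
  nonempty_Λ := ⟨_, ⟨⟨0, by simp⟩, rfl⟩⟩

end RestrictedMC

end

/-! Two facts are combined. First, finite randomness makes an algorithm nearly blind. For a fixed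
input `f` the next functional is determined by the history, an information call then has one
possible answer, and a random call has at most `|K'|`. So over all `ω` only finitely many
functionals can occur among the first `N` calls at `f`. By Markov's inequality the run at `f` stops
within `N = 4n + 4k` calls with probability at least `1/2`. On that event an input `g` that agrees
with `f` on those functionals yields the same output, so one of the two errors is at least a quarter
of the distance of the solutions (`le_minRanError_of_finite`).

Second, without the embedding a finite set of points is negligible for the Sobolev norm: some
continuous `f` in the ball vanishes on it and has integral at least `1/4`
(`exists_mem_sobolevBall_forall_eq_zero`). Comparison with the zero function gives `c = 1/16`,
whatever the finite restriction is.

In the critical case `r p = d`, `p > 1`, cutting out a point by one bump does not suffice, since the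
`L_p` norm of its derivatives of order `r` is invariant under scaling. Instead `N` bumps of scales
`4 ^ (-k)`, each of weight `1 / (2N)`, are subtracted from `1/2`. They add up to `1/2` at the point,
while their derivatives live on disjoint annuli, so that the `p`-th powers of the norms add to order
`N ^ (1 - p)`. If `m p < d` for the order `m` of the derivative, there is also a factor `4 ^ (-N (d
- m p))`, which settles `p = 1` (`lintegral_listDeriv_punctured_le`). -/

noncomputable section

namespace RestrictedMC

/-! Lower bounds for finite access restrictions -/

section LowerBound

variable {F G K Ω K' : Type*} [MeasurableSpace Ω]
variable {P : Problem F G K} {R : AccessRestriction Ω K'}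

/-! ### Runs of one algorithm on two inputs -/

namespace Algorithm

variable (A : Algorithm P R)

theorem finite_range_history [Finite K'] (f : F) (n : ℕ) :
    (range fun ω => A.history f ω n).Finite := by
  induction n with
  | zero => exact (finite_singleton []).subset (by rintro _ ⟨ω, rfl⟩; simp [history])
  | succ n ih =>
    have hfin : {a : K ⊕ K' | ∃ l ∈ (range fun ω => A.history f ω n), ∃ ω : Ω,
        a = answer (A.L l) f ω}.Finite := by
      have : {a : K ⊕ K' | ∃ l ∈ (range fun ω => A.history f ω n), ∃ ω : Ω,
          a = answer (A.L l) f ω} ⊆ (⋃ l ∈ (range fun ω => A.history f ω n),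
            {a | ∃ q : P.Λ, A.L l = Sum.inl q ∧ a = Sum.inl (q.1 f)}) ∪ range Sum.inr := by
        rintro a ⟨l, hl, ω, rfl⟩
        cases hq : A.L l with
        | inl q =>
          left
          simp only [mem_iUnion]
          exact ⟨l, hl, q, hq, rfl⟩
        | inr q => exact Or.inr ⟨_, rfl⟩
      refine Finite.subset (Finite.union (ih.biUnion fun l _ => ?_) (finite_range _)) this
      refine Set.Subsingleton.finite ?_
      rintro a ⟨q, hq, rfl⟩ b ⟨q', hq', rfl⟩
      rw [hq] at hq'
      cases hq'
      rfl
    refine (ih.image2 (fun l a => l ++ [a]) hfin).subset ?_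
    rintro _ ⟨ω, rfl⟩
    exact ⟨_, ⟨ω, rfl⟩, _, ⟨_, ⟨ω, rfl⟩, ω, rfl⟩, rfl⟩

/-- The information functionals that are among the first `N` functionals used at the input `f`, for
some `ω`. -/
def calledInfo (f : F) (N : ℕ) : Set (F → K) :=
  {l | ∃ n < N, ∃ ω, ∃ h : l ∈ P.Λ, A.query f ω n = Sum.inl ⟨l, h⟩}

theorem finite_calledInfo [Finite K'] (f : F) (N : ℕ) : (A.calledInfo f N).Finite := by
  have hsub : A.calledInfo f N ⊆ ⋃ n ∈ Iio N, ⋃ l ∈ range fun ω => A.history f ω n,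
      {q | ∃ h : q ∈ P.Λ, A.L l = Sum.inl ⟨q, h⟩} := by
    rintro q ⟨n, hn, ω, h, hq⟩
    simp only [mem_iUnion]
    exact ⟨n, hn, _, ⟨ω, rfl⟩, h, hq⟩
  refine Finite.subset ((finite_Iio N).biUnion fun n _ =>
    (A.finite_range_history f n).biUnion fun l _ => Set.Subsingleton.finite ?_) hsub
  rintro a ⟨h, ha⟩ b ⟨h', hb⟩
  rw [ha] at hb
  simpa using hb

variable {A}

/-- Equal histories lead to the same next functional. If it is an information functional it belongs
to `calledInfo f N`, a set that depends on the runs at `f` alone; if it is random its value does not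
involve the input. -/
theorem history_congr {f g : F} {N : ℕ} (h : ∀ l ∈ A.calledInfo f N, l g = l f) (ω : Ω) {n : ℕ}
    (hn : n ≤ N) : A.history g ω n = A.history f ω n := by
  induction n with
  | zero => rfl
  | succ n ih =>
    simp only [history]
    rw [ih (by omega)]
    congr 2
    cases hq : A.L (A.history f ω n) with
    | inl q => simp [answer, h q.1 ⟨n, by omega, ω, q.2, hq⟩]
    | inr q => rfl

theorem card_congr {f g : F} {N : ℕ} (h : ∀ l ∈ A.calledInfo f N, l g = l f) {ω : Ω}
    (hc : A.card f ω ≤ N) : A.card g ω = A.card f ω := by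
  have h1 : A.card f ω ≤ A.card g ω := by
    refine le_iInf₂ fun n hn => ?_
    rcases le_total n N with hnN | hnN
    · rw [history_congr h ω hnN] at hn
      exact iInf₂_le n hn
    · exact hc.trans (by exact_mod_cast hnN)
  refine le_antisymm (le_iInf₂ fun n hn => ?_) h1
  rcases le_total n N with hnN | hnN
  · rw [← history_congr h ω hnN] at hn
    exact iInf₂_le n hn
  -- A strict bound on the infimum produces an actual stopping index `m ≤ N` of the run at `f`, at
  -- which the run at `g` stops as well.
  · have hlt : A.card f ω < ((N + 1 : ℕ) : ℕ∞) :=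
      lt_of_le_of_lt hc (by exact_mod_cast Nat.lt_succ_self N)
    obtain ⟨m, hm⟩ := iInf_lt_iff.1 hlt
    obtain ⟨hτ, hm⟩ := iInf_lt_iff.1 hm
    have hmN : m ≤ N := by
      have : m < N + 1 := by exact_mod_cast hm
      omega
    rw [← history_congr h ω hmN] at hτ
    exact (iInf₂_le m hτ).trans (by exact_mod_cast hmN.trans hnN)

theorem output_congr {f g : F} {N : ℕ} (h : ∀ l ∈ A.calledInfo f N, l g = l f) {ω : Ω}
    (hc : A.card f ω ≤ N) : A.output g ω = A.output f ω := by
  rw [output, output, card_congr h hc, history_congr h ω]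
  exact ENat.toNat_le_of_le_natCast hc

variable (A)

theorem card_le_of_cardInfo_le_of_cardRand_le {f : F} {ω : Ω} {a b : ℕ}
    (ha : A.cardInfo f ω ≤ a) (hb : A.cardRand f ω ≤ b) : A.card f ω ≤ (a + b : ℕ) := by
  by_contra! hc
  have hsub : (↑(Finset.range (a + b + 1)) : Set ℕ) ⊆
      {n : ℕ | (n : ℕ∞) < A.card f ω ∧ (A.query f ω n).isLeft = true} ∪
        {n : ℕ | (n : ℕ∞) < A.card f ω ∧ (A.query f ω n).isRight = true} := by
    intro n hn
    have hn' : n ≤ a + b := by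
      have := Finset.mem_range.1 (Finset.mem_coe.1 hn)
      omega
    have hlt : (n : ℕ∞) < A.card f ω := lt_of_le_of_lt (by exact_mod_cast hn') hc
    cases hq : A.query f ω n with
    | inl q => exact Or.inl ⟨hlt, by simp [hq]⟩
    | inr q => exact Or.inr ⟨hlt, by simp [hq]⟩
  have hle := (encard_le_encard hsub).trans (encard_union_le _ _)
  rw [Set.encard_coe_eq_coe_finsetCard, Finset.card_range] at hle
  have hle' : ((a + b + 1 : ℕ) : ℕ∞) ≤ (a + b : ℕ) := by
    refine hle.trans ?_
    push_cast
    exact add_le_add ha hb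
  have : a + b + 1 ≤ a + b := by exact_mod_cast hle'
  omega

end Algorithm

/-- Markov's inequality at the threshold `4 * n + 1`, which is available because `X` takes integer
values and which also covers `n = 0`. -/
theorem measure_four_mul_lt_le {μ : Measure Ω} {X : Ω → ℕ∞} (hX : Measurable X) {n : ℕ}
    (h : ∫⁻ ω, (X ω : ℝ≥0∞) ∂μ ≤ n) : μ {ω | ((4 * n : ℕ) : ℕ∞) < X ω} ≤ 4⁻¹ := by
  have hm : Measurable fun ω => (X ω : ℝ≥0∞) :=
    (Measurable.of_discrete (f := fun m : ℕ∞ => (m : ℝ≥0∞))).comp hX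
  have h1 := (mul_meas_ge_le_lintegral (μ := μ) hm ((4 * n + 1 : ℕ) : ℝ≥0∞)).trans h
  have h2 : μ {ω | ((4 * n : ℕ) : ℕ∞) < X ω} ≤ μ {ω | ((4 * n + 1 : ℕ) : ℝ≥0∞) ≤ (X ω : ℝ≥0∞)} := by
    refine measure_mono fun ω hω => ?_
    have : ((4 * n + 1 : ℕ) : ℕ∞) ≤ X ω := by
      rw [mem_ofPred_eq] at hω
      have := Order.add_one_le_of_lt hω
      exact_mod_cast this
    have h3 := ENat.toENNReal_le.2 this
    simpa using h3
  refine h2.trans ?_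
  set m := μ {ω | ((4 * n + 1 : ℕ) : ℝ≥0∞) ≤ (X ω : ℝ≥0∞)}
  have hmul : ((4 * n + 1 : ℕ) : ℝ≥0∞) * m ≤ ((4 * n + 1 : ℕ) : ℝ≥0∞) * 4⁻¹ := by
    refine h1.trans ?_
    calc (n : ℝ≥0∞) = ((4 * n : ℕ) : ℝ≥0∞) * 4⁻¹ := by
          push_cast
          rw [mul_comm (4 : ℝ≥0∞), mul_assoc, ENNReal.mul_inv_cancel (by norm_num) (by norm_num),
            mul_one]
      _ ≤ _ := by
          gcongr
          exact Nat.le_succ _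
  exact (ENNReal.mul_le_mul_iff_right (by positivity) (ENNReal.natCast_ne_top _)).1 hmul

variable [NormedAddCommGroup G] [NormedSpace ℝ G] [CompleteSpace G]

/-- If finitely many information functionals never determine the solution at `f` up to `δ`,
then a finite access restriction does not allow an error below `δ / 4`. -/
theorem le_minRanError_of_finite (hR : R.IsFinite) (f : F) {δ : ℝ≥0∞}
    (hδ : ∀ T : Set (F → K), T.Finite → T ⊆ P.Λ →
      ∃ g : F, (∀ l ∈ T, l g = l f) ∧ δ ≤ ‖P.S g - P.S f‖ₑ) (n k : ℕ) :
    δ / 4 ≤ minRanError P R n k := by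
  have := hR.1
  have := R.isProb
  refine le_iInf₂ fun A hA => ?_
  set N := 4 * n + 4 * k with hN
  obtain ⟨g, hg, hgδ⟩ := hδ (A.calledInfo f N) (A.finite_calledInfo f N)
    (by rintro l ⟨_, _, _, h, _⟩; exact h)
  set B : Set Ω := {ω | ((4 * n : ℕ) : ℕ∞) < A.cardInfo f ω} ∪
    {ω | ((4 * k : ℕ) : ℕ∞) < A.cardRand f ω} with hB
  have hBm : MeasurableSet B :=
    ((hA.isMeas.measurable_cardInfo f) (MeasurableSet.of_discrete (s := Ioi ((4 * n : ℕ) : ℕ∞)))).union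
      ((hA.isMeas.measurable_cardRand f) (MeasurableSet.of_discrete (s := Ioi ((4 * k : ℕ) : ℕ∞))))
  have hBle : R.ℙ B ≤ 2⁻¹ := by
    refine (measure_union_le _ _).trans ?_
    refine (add_le_add (measure_four_mul_lt_le (hA.isMeas.measurable_cardInfo f) (hA.cardInfo_le f))
      (measure_four_mul_lt_le (hA.isMeas.measurable_cardRand f) (hA.cardRand_le f))).trans ?_
    rw [← ENNReal.toReal_le_toReal (by finiteness) (by finiteness)]
    rw [ENNReal.toReal_add (by finiteness) (by finiteness)]
    norm_num
  have hBc : 2⁻¹ ≤ R.ℙ Bᶜ := by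
    rw [prob_compl_eq_one_sub hBm]
    refine ENNReal.le_sub_of_add_le_right (by finiteness) ?_
    exact (add_le_add_right hBle _).trans (ENNReal.inv_two_add_inv_two).le
  have hout : ∀ ω ∈ Bᶜ, A.output g ω = A.output f ω := by
    intro ω hω
    simp only [hB, mem_compl_iff, mem_union, mem_ofPred_eq, not_or, not_lt] at hω
    exact Algorithm.output_congr hg (A.card_le_of_cardInfo_le_of_cardRand_le hω.1 hω.2)
  have hmeas : Measurable fun ω => ‖P.S f - A.output f ω‖ₑ := by
    let : MeasurableSpace G := borel G
    have : BorelSpace G := ⟨rfl⟩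
    have hc : Continuous fun x : G => ‖P.S f - x‖ₑ := by fun_prop
    exact hc.measurable.comp (hA.isMeas.measurable_output f)
  -- On `Bᶜ` a single output serves both `f` and `g`, so by the triangle inequality the two errors
  -- add up to at least `δ` there.
  have hsum : δ / 2 ≤ A.error + A.error := by
    calc δ / 2 = δ * 2⁻¹ := div_eq_mul_inv _ _
      _ ≤ δ * R.ℙ Bᶜ := by gcongr
      _ = ∫⁻ _ in Bᶜ, δ ∂(R.ℙ) := by simp
      _ ≤ ∫⁻ ω in Bᶜ, (‖P.S f - A.output f ω‖ₑ + ‖P.S g - A.output g ω‖ₑ) ∂(R.ℙ) := by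
          refine setLIntegral_mono' hBm.compl fun ω hω => ?_
          rw [hout ω hω]
          refine hgδ.trans ?_
          have : P.S g - P.S f = -(P.S f - A.output f ω) + (P.S g - A.output f ω) := by abel
          rw [this]
          exact (enorm_add_le _ _).trans (by rw [enorm_neg])
      _ ≤ ∫⁻ ω, (‖P.S f - A.output f ω‖ₑ + ‖P.S g - A.output g ω‖ₑ) ∂(R.ℙ) :=
          setLIntegral_le_lintegral _ _
      _ = (∫⁻ ω, ‖P.S f - A.output f ω‖ₑ ∂(R.ℙ)) + ∫⁻ ω, ‖P.S g - A.output g ω‖ₑ ∂(R.ℙ) :=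
          lintegral_add_left hmeas _
      _ ≤ A.error + A.error :=
          add_le_add (le_iSup (fun f => ∫⁻ ω, ‖P.S f - A.output f ω‖ₑ ∂(R.ℙ)) f)
            (le_iSup (fun f => ∫⁻ ω, ‖P.S f - A.output f ω‖ₑ ∂(R.ℙ)) g)
  have h4 : δ / 4 = δ / 2 / 2 := by
    rw [div_eq_mul_inv, div_eq_mul_inv, div_eq_mul_inv, mul_assoc,
      ← ENNReal.mul_inv (by norm_num) (by norm_num)]
    norm_num
  rw [h4]
  refine ENNReal.div_le_of_le_mul ?_
  rwa [mul_two]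

end LowerBound

/-! Iterated partial derivatives -/

section Derivatives

open scoped ContDiff

variable {d : ℕ}

/-- The iterated partial derivative in the directions of the entries of a list. -/
def listDeriv (l : List (Fin d)) (g : (Fin d → ℝ) → ℝ) : (Fin d → ℝ) → ℝ :=
  l.foldr partialDeriv g

theorem listDeriv_cons (i : Fin d) (l : List (Fin d)) (g : (Fin d → ℝ) → ℝ) :
    listDeriv (i :: l) g = partialDeriv i (listDeriv l g) := rfl

theorem listDeriv_append (l l' : List (Fin d)) (g : (Fin d → ℝ) → ℝ) :
    listDeriv (l ++ l') g = listDeriv l (listDeriv l' g) := by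
  simp [listDeriv]

theorem listDeriv_replicate (i : Fin d) (n : ℕ) (g : (Fin d → ℝ) → ℝ) :
    listDeriv (List.replicate n i) g = (partialDeriv i)^[n] g := by
  induction n with
  | zero => rfl
  | succ n ih => rw [List.replicate_succ, listDeriv_cons, ih, Function.iterate_succ_apply']

/-- The list of directions of a multi-index. -/
def directions (α : Fin d → ℕ) : List (Fin d) :=
  (List.finRange d).flatMap fun i => List.replicate (α i) i

theorem length_directions (α : Fin d → ℕ) : (directions α).length = ∑ i, α i := by
  simp [directions, List.length_flatMap, Fin.sum_univ_def]

/-- Lists of directions allow induction on one derivative at a time and keep track of the order of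
differentiation. -/
theorem multiDeriv_eq_listDeriv (α : Fin d → ℕ) (g : (Fin d → ℝ) → ℝ) :
    multiDeriv α g = listDeriv (directions α) g := by
  unfold multiDeriv directions
  induction List.finRange d with
  | nil => rfl
  | cons i l ih =>
    rw [List.flatMap_cons, listDeriv_append, listDeriv_replicate, List.foldr_cons, ih]

theorem contDiff_partialDeriv {g : (Fin d → ℝ) → ℝ} (hg : ContDiff ℝ ∞ g) (i : Fin d) :
    ContDiff ℝ ∞ (partialDeriv i g) :=
  (hg.fderiv_right (m := ∞) le_rfl).clm_apply contDiff_const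

theorem contDiff_listDeriv {g : (Fin d → ℝ) → ℝ} (hg : ContDiff ℝ ∞ g) (l : List (Fin d)) :
    ContDiff ℝ ∞ (listDeriv l g) := by
  induction l with
  | nil => exact hg
  | cons i l ih => exact contDiff_partialDeriv ih i

theorem tsupport_partialDeriv_subset (g : (Fin d → ℝ) → ℝ) (i : Fin d) :
    tsupport (partialDeriv i g) ⊆ tsupport g :=
  (closure_mono (Function.support_subset_iff'.2 fun x hx => by
    have : fderiv ℝ g x = 0 := Function.notMem_support.1 fun h => hx (support_fderiv_subset ℝ h)
    simp [partialDeriv, this])).trans (isClosed_tsupport g).closure_subset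

theorem tsupport_listDeriv_subset (g : (Fin d → ℝ) → ℝ) (l : List (Fin d)) :
    tsupport (listDeriv l g) ⊆ tsupport g := by
  induction l with
  | nil => exact le_rfl
  | cons i l ih => exact (tsupport_partialDeriv_subset _ i).trans ih

theorem listDeriv_congr_of_isOpen {g h : (Fin d → ℝ) → ℝ} {U : Set (Fin d → ℝ)} (hU : IsOpen U)
    (hgh : EqOn g h U) (l : List (Fin d)) : EqOn (listDeriv l g) (listDeriv l h) U := by
  induction l with
  | nil => exact hgh
  | cons i l ih =>
    intro x hx
    have : listDeriv l g =ᶠ[nhds x] listDeriv l h := ih.eventuallyEq_of_mem (hU.mem_nhds hx)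
    simp [listDeriv_cons, partialDeriv, this.fderiv_eq]

theorem listDeriv_const (c : ℝ) {l : List (Fin d)} (hl : l ≠ []) :
    listDeriv l (fun _ => c) = fun _ => 0 := by
  induction l with
  | nil => exact absurd rfl hl
  | cons i l ih =>
    rw [listDeriv_cons]
    by_cases h : l = []
    · subst h
      funext x
      simp [listDeriv, partialDeriv]
    · rw [ih h]
      funext x
      simp [partialDeriv]

theorem listDeriv_comp_smul_sub (g : (Fin d → ℝ) → ℝ) (c : ℝ) (a : Fin d → ℝ) (l : List (Fin d)) :
    listDeriv l (fun x => g (c • (x - a))) =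
      fun x => c ^ l.length * listDeriv l g (c • (x - a)) := by
  induction l with
  | nil => simp [listDeriv]
  | cons i l ih =>
    rw [listDeriv_cons, ih]
    funext x
    have h1 : fderiv ℝ (fun x => listDeriv l g (c • (x - a))) x =
        c • fderiv ℝ (listDeriv l g) (c • (x - a)) := by
      rw [fderiv_comp_sub (f := fun y => listDeriv l g (c • y)) a, fderiv_comp_smul]
    have h2 : (fun x => c ^ l.length * listDeriv l g (c • (x - a))) =
        c ^ l.length • fun x => listDeriv l g (c • (x - a)) := by
      funext x; simp
    rw [partialDeriv, h2, fderiv_const_smul_field, Pi.smul_apply, h1]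
    simp [listDeriv_cons, partialDeriv, pow_succ]
    ring

theorem listDeriv_const_sub_sum {ι : Type*} (s : Finset ι) (c b : ℝ)
    (G : ι → (Fin d → ℝ) → ℝ) (hG : ∀ i ∈ s, ContDiff ℝ ∞ (G i)) {l : List (Fin d)} (hl : l ≠ []) :
    listDeriv l (fun x => c - b * ∑ i ∈ s, G i x) = fun x => - (b * ∑ i ∈ s, listDeriv l (G i) x) := by
  induction l with
  | nil => exact absurd rfl hl
  | cons j l ih =>
    have hdiff : ∀ i ∈ s, ∀ x, DifferentiableAt ℝ (listDeriv l (G i)) x := fun i hi x =>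
      (contDiff_listDeriv (hG i hi) l).differentiable (by simp) x
    have key : ∀ x, fderiv ℝ (fun x => b * ∑ i ∈ s, listDeriv l (G i) x) x =
        b • ∑ i ∈ s, fderiv ℝ (listDeriv l (G i)) x := by
      intro x
      rw [fderiv_const_mul (DifferentiableAt.fun_sum fun i hi => hdiff i hi x),
        fderiv_fun_sum fun i hi => hdiff i hi x]
    rw [listDeriv_cons]
    -- The constant `c` disappears only with the innermost derivative, so the induction hypothesis
    -- is not available for a single direction.
    by_cases h : l = []
    · subst h
      funext x
      have := key x
      simp only [listDeriv, List.foldr_nil] at this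
      simp [partialDeriv, listDeriv, fderiv_const_sub, this]
    · rw [ih h]
      funext x
      simp [partialDeriv, fderiv_fun_neg, key, listDeriv_cons]

theorem integral_mul_partialDeriv {f φ : (Fin d → ℝ) → ℝ} (hf : ContDiff ℝ ∞ f)
    (hφ : ContDiff ℝ ∞ φ) (hc : HasCompactSupport φ) (i : Fin d) :
    ∫ x, f x * partialDeriv i φ x = - ∫ x, partialDeriv i f x * φ x := by
  have hci : HasCompactSupport (partialDeriv i φ) :=
    hc.of_isClosed_subset (isClosed_tsupport _) (tsupport_partialDeriv_subset φ i)
  refine integral_mul_fderiv_eq_neg_fderiv_mul_of_integrable ?_ ?_ ?_ ?_ ?_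
  · exact ((contDiff_partialDeriv hf i).continuous.mul hφ.continuous).integrable_of_hasCompactSupport
      hc.mul_left
  · exact (hf.continuous.mul (contDiff_partialDeriv hφ i).continuous).integrable_of_hasCompactSupport
      hci.mul_left
  · exact (hf.continuous.mul hφ.continuous).integrable_of_hasCompactSupport hc.mul_left
  · exact fun x _ => hf.differentiable (by simp) x
  · exact fun x _ => hφ.differentiable (by simp) x

/-- Integration by parts moves the outermost derivative of `φ` first, where it becomes the innermost
one of `f`. Keeping the reversed list makes it unnecessary to commute partial derivatives. -/
theorem integral_mul_listDeriv {f φ : (Fin d → ℝ) → ℝ} (hf : ContDiff ℝ ∞ f)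
    (hφ : ContDiff ℝ ∞ φ) (hc : HasCompactSupport φ) (l : List (Fin d)) :
    ∫ x, f x * listDeriv l φ x = (-1) ^ l.length * ∫ x, listDeriv l.reverse f x * φ x := by
  induction l generalizing f with
  | nil => simp [listDeriv]
  | cons i l ih =>
    have hcl : HasCompactSupport (listDeriv l φ) :=
      hc.of_isClosed_subset (isClosed_tsupport _) (tsupport_listDeriv_subset φ l)
    rw [listDeriv_cons, integral_mul_partialDeriv hf (contDiff_listDeriv hφ l) hcl,
      ih (contDiff_partialDeriv hf i), List.reverse_cons, listDeriv_append, List.length_cons,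
      pow_succ]
    simp [listDeriv]

theorem hasWeakDeriv_of_contDiff {U : Set (Fin d → ℝ)} (hU : IsOpen U) {u f : (Fin d → ℝ) → ℝ}
    (hf : ContDiff ℝ ∞ f) (huf : EqOn u f U) (α : Fin d → ℕ) :
    HasWeakDeriv U α u (listDeriv (directions α).reverse f) where
  locInt_left := by
    refine LocallyIntegrableOn.congr ?_ (hf.continuous.locallyIntegrable.locallyIntegrableOn U)
    exact (ae_restrict_iff' hU.measurableSet).2 (ae_of_all _ fun x hx => (huf hx).symm)
  locInt_right := (contDiff_listDeriv hf _).continuous.locallyIntegrable.locallyIntegrableOn U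
  integral_eq φ hφ hc hs := by
    have h1 : ∫ x in U, u x * multiDeriv α φ x = ∫ x, f x * multiDeriv α φ x := by
      rw [setIntegral_congr_fun hU.measurableSet
        (g := fun x => f x * multiDeriv α φ x) fun x hx => by simp only [huf hx]]
      refine setIntegral_eq_integral_of_forall_compl_eq_zero fun x hx => ?_
      rw [multiDeriv_eq_listDeriv, image_eq_zero_of_notMem_tsupport fun h =>
        hx (hs (tsupport_listDeriv_subset φ _ h)), mul_zero]
    have h2 : ∫ x in U, listDeriv (directions α).reverse f x * φ x =
        ∫ x, listDeriv (directions α).reverse f x * φ x := by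
      refine setIntegral_eq_integral_of_forall_compl_eq_zero fun x hx => ?_
      rw [image_eq_zero_of_notMem_tsupport fun h => hx (hs h), mul_zero]
    rw [h1, h2, multiDeriv_eq_listDeriv, integral_mul_listDeriv hf hφ hc, length_directions]

theorem sobolevENorm_le_of_contDiff (r : ℕ) (p : ℝ) {U : Set (Fin d → ℝ)} (hU : IsOpen U)
    {u f : (Fin d → ℝ) → ℝ} (hf : ContDiff ℝ ∞ f) (huf : EqOn u f U) :
    sobolevENorm r p U u ≤ (∑ α ∈ multiIndices d r, eLpNorm (listDeriv (directions α).reverse f)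
      (ENNReal.ofReal p) (volume.restrict U) ^ p) ^ (1 / p) :=
  iInf₂_le (fun α => listDeriv (directions α).reverse f)
    fun α _ => hasWeakDeriv_of_contDiff hU hf huf α

end Derivatives

/-! Functions in the unit ball that vanish at given points -/

section Punctured

open scoped ContDiff
open Filter

/-- At each point at most one summand is nonzero, so the `p`-th power of the sum is taken term by
term, without the power of the number of terms that a general inequality would cost. -/
theorem lintegral_enorm_sum_rpow_le {X ι : Type*} [MeasurableSpace X] (μ : Measure X)
    (s : Finset ι) {S : ι → Set X} (hS : ∀ i ∈ s, MeasurableSet (S i))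
    (hd : (s : Set ι).PairwiseDisjoint S) {b : ι → X → ℝ} {B : ι → ℝ≥0∞} {p : ℝ} (hp : 0 < p)
    (hb : ∀ i ∈ s, ∀ x, ‖b i x‖ₑ ≤ B i) (hb0 : ∀ i ∈ s, ∀ x, x ∉ S i → b i x = 0) :
    ∫⁻ x, ‖∑ i ∈ s, b i x‖ₑ ^ p ∂μ ≤ ∑ i ∈ s, B i ^ p * μ (S i) := by
  have h1 : ∀ x, ‖∑ i ∈ s, b i x‖ₑ ^ p ≤ ∑ i ∈ s, (S i).indicator (fun _ => B i ^ p) x := by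
    intro x
    by_cases hx : ∃ i ∈ s, x ∈ S i
    · obtain ⟨i, hi, hxi⟩ := hx
      have : ∑ j ∈ s, b j x = b i x := by
        refine Finset.sum_eq_single_of_mem i hi fun j hj hji => hb0 j hj x fun hxj => ?_
        exact disjoint_left.1 (hd hj hi hji) hxj hxi
      rw [this]
      calc ‖b i x‖ₑ ^ p ≤ B i ^ p := ENNReal.rpow_le_rpow (hb i hi x) hp.le
        _ = (S i).indicator (fun _ => B i ^ p) x := by rw [indicator_of_mem hxi]
        _ ≤ _ := Finset.single_le_sum (f := fun i => (S i).indicator (fun _ => B i ^ p) x)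
            (fun _ _ => zero_le) hi
    · push Not at hx
      rw [Finset.sum_eq_zero fun i hi => hb0 i hi x (hx i hi)]
      simp [hp]
  refine (lintegral_mono h1).trans ?_
  rw [lintegral_finsetSum' _ fun i hi => (measurable_const.indicator (hS i hi)).aemeasurable]
  exact Finset.sum_le_sum fun i hi => by rw [lintegral_indicator_const (hS i hi)]

/-! ### Plateau functions and their superposition over many scales -/

variable {d : ℕ}

/-- A smooth function with values in `[0, 1]` that is `1` on the unit ball and `0` outside of the
ball of radius `2`. -/
structure IsPlateau (η : (Fin d → ℝ) → ℝ) : Prop where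
  contDiff : ContDiff ℝ ∞ η
  nonneg : ∀ x, 0 ≤ η x
  le_one : ∀ x, η x ≤ 1
  eq_one : ∀ x, ‖x‖ ≤ 1 → η x = 1
  eq_zero : ∀ x, 2 ≤ ‖x‖ → η x = 0

theorem exists_isPlateau (d : ℕ) : ∃ η : (Fin d → ℝ) → ℝ, IsPlateau η := by
  let η : ContDiffBump (0 : Fin d → ℝ) := ⟨1, 2, by norm_num, by norm_num⟩
  exact ⟨η, η.contDiff, fun x => η.nonneg, fun x => η.le_one,
    fun x hx => η.one_of_mem_closedBall (by simpa [η] using hx),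
    fun x hx => η.zero_of_le_dist (by simpa [η] using hx)⟩

namespace IsPlateau

variable {η : (Fin d → ℝ) → ℝ} (hη : IsPlateau η)

include hη

theorem hasCompactSupport : HasCompactSupport η :=
  HasCompactSupport.intro (isCompact_closedBall (0 : Fin d → ℝ) 2) fun x hx =>
    hη.eq_zero x (by simpa using (lt_of_not_ge fun h => hx (by simpa using h)).le)

theorem exists_listDeriv_bound (l : List (Fin d)) : ∃ M : ℝ, 0 ≤ M ∧ ∀ x, |listDeriv l η x| ≤ M := by
  have hc : HasCompactSupport (listDeriv l η) :=
    hη.hasCompactSupport.of_isClosed_subset (isClosed_tsupport _) (tsupport_listDeriv_subset η l)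
  obtain ⟨M, hM⟩ := hc.exists_bound_of_continuous (contDiff_listDeriv hη.contDiff l).continuous
  exact ⟨M, (norm_nonneg _).trans (hM 0), hM⟩

/-- `η` is locally constant on both open regions. This confines the derivatives of a rescaled
plateau to an annulus. -/
theorem listDeriv_eq_zero {l : List (Fin d)} (hl : l ≠ []) {x : Fin d → ℝ}
    (hx : ‖x‖ < 1 ∨ 2 < ‖x‖) : listDeriv l η x = 0 := by
  rcases hx with hx | hx
  · have := listDeriv_congr_of_isOpen (g := η) (h := fun _ => 1)
      (isOpen_lt continuous_norm continuous_const) (fun y hy => hη.eq_one y (le_of_lt hy)) l hx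
    rw [this, listDeriv_const 1 hl]
  · have := listDeriv_congr_of_isOpen (g := η) (h := fun _ => 0)
      (isOpen_lt continuous_const continuous_norm) (fun y hy => hη.eq_zero y (le_of_lt hy)) l hx
    rw [this, listDeriv_const 0 hl]

end IsPlateau

/-- The constant `1 / 2`, modified near the points of `X` on the scales `4 ^ (-k)` for
`N < k ≤ 2 * N`. -/
def punctured (η : (Fin d → ℝ) → ℝ) (X : Finset (Fin d → ℝ)) (N : ℕ) (x : Fin d → ℝ) : ℝ :=
  1 / 2 - (2 * (N : ℝ))⁻¹ * ∑ q ∈ X ×ˢ Finset.Ioc N (2 * N), η ((4 : ℝ) ^ q.2 • (x - q.1))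

theorem norm_sub_le_of_norm_smul_le {x a : Fin d → ℝ} {N k : ℕ} (hk : N < k)
    (h : ‖(4 : ℝ) ^ k • (x - a)‖ ≤ 2) : ‖x - a‖ ≤ 2 * ((4 : ℝ) ^ N)⁻¹ := by
  rw [norm_smul, Real.norm_of_nonneg (by positivity)] at h
  have h1 : (4 : ℝ) ^ N ≤ 4 ^ k := pow_le_pow_right₀ (by norm_num) hk.le
  rw [← div_eq_mul_inv, le_div_iff₀ (by positivity), mul_comm]
  exact (mul_le_mul_of_nonneg_right h1 (norm_nonneg _)).trans h

/-- The points of `X` have distances greater than `4 * 4 ^ (-N)`. -/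
def IsSeparatedAt (X : Finset (Fin d → ℝ)) (N : ℕ) : Prop :=
  ∀ a ∈ X, ∀ b ∈ X, a ≠ b → 4 * ((4 : ℝ) ^ N)⁻¹ < ‖a - b‖

theorem IsSeparatedAt.eq {X : Finset (Fin d → ℝ)} {N : ℕ} (hX : IsSeparatedAt X N)
    {a b x : Fin d → ℝ} (ha : a ∈ X) (hb : b ∈ X) (hxa : ‖x - a‖ ≤ 2 * ((4 : ℝ) ^ N)⁻¹)
    (hxb : ‖x - b‖ ≤ 2 * ((4 : ℝ) ^ N)⁻¹) : a = b := by
  by_contra hab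
  have h1 := hX a ha b hb hab
  have h2 : ‖a - b‖ ≤ ‖x - b‖ + ‖x - a‖ := by
    have : a - b = (x - b) - (x - a) := by abel
    rw [this]
    exact norm_sub_le _ _
  linarith

theorem tendsto_inv_four_pow : Tendsto (fun N : ℕ => ((4 : ℝ) ^ N)⁻¹) atTop (nhds 0) :=
  tendsto_inv_atTop_zero.comp (tendsto_pow_atTop_atTop_of_one_lt (by norm_num))

theorem eventually_isSeparatedAt (X : Finset (Fin d → ℝ)) : ∀ᶠ N in atTop, IsSeparatedAt X N := by
  refine (Filter.eventually_all_finset X).2 fun a _ => (Filter.eventually_all_finset X).2 fun b _ => ?_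
  by_cases hab : a = b
  · exact Eventually.of_forall fun _ h => absurd hab h
  · have h : Tendsto (fun N : ℕ => 4 * ((4 : ℝ) ^ N)⁻¹) atTop (nhds 0) := by
      simpa using tendsto_inv_four_pow.const_mul 4
    filter_upwards [h.eventually_lt_const (norm_pos_iff.2 (sub_ne_zero.2 hab))] with N hN _
    exact hN

/-! ### Values and derivatives of the punctured functions -/

section Bounds

variable {η : (Fin d → ℝ) → ℝ} (hη : IsPlateau η) {X : Finset (Fin d → ℝ)} {N : ℕ}

include hη

theorem contDiff_punctured (X : Finset (Fin d → ℝ)) (N : ℕ) : ContDiff ℝ ∞ (punctured η X N) := by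
  unfold punctured
  refine contDiff_const.sub (contDiff_const.mul (ContDiff.sum fun q _ => hη.contDiff.comp ?_))
  fun_prop

theorem plateau_scaled_eq_zero {x a : Fin d → ℝ} {k : ℕ} (hk : N < k)
    (h : 2 * ((4 : ℝ) ^ N)⁻¹ < ‖x - a‖) : η ((4 : ℝ) ^ k • (x - a)) = 0 := by
  refine hη.eq_zero _ ?_
  by_contra! h'
  exact absurd (norm_sub_le_of_norm_smul_le hk h'.le) (not_le.2 h)

theorem punctured_eq_half {x : Fin d → ℝ} (hx : ∀ a ∈ X, 2 * ((4 : ℝ) ^ N)⁻¹ < ‖x - a‖) :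
    punctured η X N x = 1 / 2 := by
  rw [punctured, Finset.sum_eq_zero, mul_zero, sub_zero]
  rintro ⟨a, k⟩ hq
  obtain ⟨ha, hk⟩ := Finset.mem_product.1 hq
  exact plateau_scaled_eq_zero hη (Finset.mem_Ioc.1 hk).1 (hx a ha)

theorem punctured_eq_of_near (hX : IsSeparatedAt X N) {a x : Fin d → ℝ} (ha : a ∈ X)
    (hx : ‖x - a‖ ≤ 2 * ((4 : ℝ) ^ N)⁻¹) : punctured η X N x =
      1 / 2 - (2 * (N : ℝ))⁻¹ * ∑ k ∈ Finset.Ioc N (2 * N), η ((4 : ℝ) ^ k • (x - a)) := by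
  rw [punctured, Finset.sum_product, Finset.sum_eq_single_of_mem a ha]
  intro b hb hba
  refine Finset.sum_eq_zero fun k hk => plateau_scaled_eq_zero hη (Finset.mem_Ioc.1 hk).1 ?_
  by_contra! h
  exact hba (hX.eq hb ha h hx)

theorem punctured_eq_zero (hX : IsSeparatedAt X N) (hN : 0 < N) {a : Fin d → ℝ} (ha : a ∈ X) :
    punctured η X N a = 0 := by
  rw [punctured_eq_of_near hη hX ha (by simp)]
  have hN' : (N : ℝ) ≠ 0 := by positivity
  simp only [sub_self, smul_zero, hη.eq_one 0 (by simp), Finset.sum_const, Nat.card_Ioc,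
    nsmul_eq_mul, mul_one]
  rw [show 2 * N - N = N by omega]
  field_simp
  norm_num

theorem punctured_mem_Icc (hX : IsSeparatedAt X N) (hN : 0 < N) (x : Fin d → ℝ) :
    punctured η X N x ∈ Icc (0 : ℝ) (1 / 2) := by
  by_cases h : ∀ a ∈ X, 2 * ((4 : ℝ) ^ N)⁻¹ < ‖x - a‖
  · rw [punctured_eq_half hη h]
    norm_num
  · push Not at h
    obtain ⟨a, ha, hx⟩ := h
    rw [punctured_eq_of_near hη hX ha hx]
    have h0 : 0 ≤ ∑ k ∈ Finset.Ioc N (2 * N), η ((4 : ℝ) ^ k • (x - a)) :=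
      Finset.sum_nonneg fun k _ => hη.nonneg _
    have h1 : ∑ k ∈ Finset.Ioc N (2 * N), η ((4 : ℝ) ^ k • (x - a)) ≤ N := by
      refine (Finset.sum_le_card_nsmul _ _ 1 fun k _ => hη.le_one _).trans ?_
      simp [show 2 * N - N = N by omega]
    have hN' : (0 : ℝ) < N := by positivity
    constructor
    · have : (2 * (N : ℝ))⁻¹ * ∑ k ∈ Finset.Ioc N (2 * N), η ((4 : ℝ) ^ k • (x - a)) ≤
          (2 * (N : ℝ))⁻¹ * N := by gcongr
      have h2 : (2 * (N : ℝ))⁻¹ * N = 1 / 2 := by field_simp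
      linarith
    · have : 0 ≤ (2 * (N : ℝ))⁻¹ * ∑ k ∈ Finset.Ioc N (2 * N), η ((4 : ℝ) ^ k • (x - a)) := by
        positivity
      linarith

theorem listDeriv_punctured (X : Finset (Fin d → ℝ)) (N : ℕ) {l : List (Fin d)} (hl : l ≠ []) :
    listDeriv l (punctured η X N) = fun x => ∑ q ∈ X ×ˢ Finset.Ioc N (2 * N),
      -((2 * (N : ℝ))⁻¹ * (((4 : ℝ) ^ q.2) ^ l.length *
        listDeriv l η ((4 : ℝ) ^ q.2 • (x - q.1)))) := by
  have := listDeriv_const_sub_sum (X ×ˢ Finset.Ioc N (2 * N)) (1 / 2) (2 * (N : ℝ))⁻¹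
    (fun q x => η ((4 : ℝ) ^ q.2 • (x - q.1)))
    (fun q _ => hη.contDiff.comp (by fun_prop)) hl
  refine this.trans ?_
  funext x
  simp only [listDeriv_comp_smul_sub, Finset.mul_sum, Finset.sum_neg_distrib]

/-- With `m = l.length`, the bump at scale `4 ^ (-k)` contributes a derivative of size at most `N⁻¹
* 4 ^ (k m) * M` on an annulus of volume at most `4 ^ d * 4 ^ (-k d)`. There are `X.card * N`
disjoint annuli. -/
theorem lintegral_listDeriv_punctured_le (hX : IsSeparatedAt X N) {p : ℝ} (hp : 0 < p)
    {l : List (Fin d)} (hl : l ≠ []) (hlp : l.length * p ≤ d) {M : ℝ} (hM0 : 0 ≤ M)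
    (hM : ∀ x, |listDeriv l η x| ≤ M) :
    ∫⁻ x, ‖listDeriv l (punctured η X N) x‖ₑ ^ p ≤
      ENNReal.ofReal (X.card * (M ^ p * 4 ^ d) *
        (N * ((N : ℝ)⁻¹) ^ p * (4 : ℝ) ^ (-(N * (d - l.length * p))))) := by
  set S : (Fin d → ℝ) × ℕ → Set (Fin d → ℝ) := fun q =>
    {x | 1 ≤ ‖(4 : ℝ) ^ q.2 • (x - q.1)‖ ∧ ‖(4 : ℝ) ^ q.2 • (x - q.1)‖ ≤ 2} with hS
  have hSm : ∀ q, MeasurableSet (S q) := by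
    intro q
    have hc : Continuous fun x : Fin d → ℝ => ‖(4 : ℝ) ^ q.2 • (x - q.1)‖ := by fun_prop
    exact ((isClosed_le continuous_const hc).inter (isClosed_le hc continuous_const)).measurableSet
  have hSd : ((X ×ˢ Finset.Ioc N (2 * N) : Finset _) : Set ((Fin d → ℝ) × ℕ)).PairwiseDisjoint S := by
    -- Passing to a finer scale multiplies the rescaled norm by at least `4`, beyond the outer
    -- radius `2`; a ratio of `2` would let neighbouring annuli touch.
    have key : ∀ (a x : Fin d → ℝ) (k j : ℕ), k < j → 1 ≤ ‖(4 : ℝ) ^ k • (x - a)‖ →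
        ‖(4 : ℝ) ^ j • (x - a)‖ ≤ 2 → False := by
      intro a x k j hkj h1 h2
      rw [norm_smul, Real.norm_of_nonneg (by positivity)] at h1 h2
      have h3 : (4 : ℝ) ^ (k + 1) ≤ 4 ^ j := pow_le_pow_right₀ (by norm_num) hkj
      have h4 := mul_le_mul_of_nonneg_right h3 (norm_nonneg (x - a))
      rw [pow_succ] at h4
      linarith
    rintro ⟨a, k⟩ hq ⟨b, j⟩ hq' hne
    obtain ⟨ha, hk⟩ := Finset.mem_product.1 (Finset.mem_coe.1 hq)
    obtain ⟨hb, hj⟩ := Finset.mem_product.1 (Finset.mem_coe.1 hq')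
    refine disjoint_left.2 fun x hx hx' => ?_
    have hab : a = b := hX.eq ha hb (norm_sub_le_of_norm_smul_le (Finset.mem_Ioc.1 hk).1 hx.2)
      (norm_sub_le_of_norm_smul_le (Finset.mem_Ioc.1 hj).1 hx'.2)
    subst hab
    rcases lt_trichotomy k j with h | h | h
    · exact key a x k j h hx.1 hx'.2
    · exact hne (by rw [h])
    · exact key a x j k h hx'.1 hx.2
  rw [listDeriv_punctured hη X N hl]
  refine (lintegral_enorm_sum_rpow_le volume _ (fun q _ => hSm q) hSd (p := p) hp
    (B := fun q => ENNReal.ofReal ((N : ℝ)⁻¹ * (((4 : ℝ) ^ q.2) ^ l.length * M))) ?_ ?_).trans ?_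
  · intro q _ x
    rw [Real.enorm_eq_ofReal_abs]
    refine ENNReal.ofReal_le_ofReal ?_
    rw [abs_neg, abs_mul, abs_mul, abs_of_nonneg (by positivity : (0 : ℝ) ≤ (2 * (N : ℝ))⁻¹),
      abs_of_nonneg (by positivity : (0 : ℝ) ≤ ((4 : ℝ) ^ q.2) ^ l.length), mul_inv]
    have := hM ((4 : ℝ) ^ q.2 • (x - q.1))
    have h2 : (2 : ℝ)⁻¹ * (N : ℝ)⁻¹ ≤ (N : ℝ)⁻¹ := by
      have : (0 : ℝ) ≤ (N : ℝ)⁻¹ := by positivity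
      linarith
    gcongr
  · intro q _ x hx
    rw [hη.listDeriv_eq_zero hl]
    · simp
    · by_contra! h
      exact hx h
  · have hterm : ∀ q ∈ X ×ˢ Finset.Ioc N (2 * N),
        ENNReal.ofReal ((N : ℝ)⁻¹ * (((4 : ℝ) ^ q.2) ^ l.length * M)) ^ p * volume (S q) ≤
        ENNReal.ofReal ((M ^ p * 4 ^ d) *
          (((N : ℝ)⁻¹) ^ p * (4 : ℝ) ^ (-(N * (d - l.length * p))))) := by
      rintro ⟨a, k⟩ hq
      have hk : N < k := (Finset.mem_Ioc.1 (Finset.mem_product.1 hq).2).1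
      have hvol : volume (S (a, k)) ≤ ENNReal.ofReal ((2 * (2 * ((4 : ℝ) ^ k)⁻¹)) ^ d) := by
        have hsub : S (a, k) ⊆ Metric.closedBall a (2 * ((4 : ℝ) ^ k)⁻¹) := by
          intro x hx
          have h2 := hx.2
          rw [norm_smul, Real.norm_of_nonneg (by positivity)] at h2
          rw [Metric.mem_closedBall, dist_eq_norm, ← div_eq_mul_inv, le_div_iff₀ (by positivity),
            mul_comm]
          exact h2
        refine (measure_mono hsub).trans ?_
        rw [Real.volume_pi_closedBall a (by positivity), Fintype.card_fin]
      refine (mul_le_mul_right hvol _).trans ?_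
      rw [ENNReal.ofReal_rpow_of_nonneg (by positivity) hp.le, ← ENNReal.ofReal_mul (by positivity)]
      refine ENNReal.ofReal_le_ofReal ?_
      have e1 : ((N : ℝ)⁻¹ * (((4 : ℝ) ^ k) ^ l.length * M)) ^ p =
          ((N : ℝ)⁻¹) ^ p * ((4 : ℝ) ^ (k * (l.length * p) : ℝ) * M ^ p) := by
        rw [Real.mul_rpow (by positivity) (by positivity),
          Real.mul_rpow (by positivity) hM0, ← pow_mul, ← Real.rpow_natCast,
          ← Real.rpow_mul (by norm_num)]
        push_cast
        rw [mul_assoc (k : ℝ)]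
      have e2 : (2 * (2 * ((4 : ℝ) ^ k)⁻¹)) ^ d = 4 ^ d * (4 : ℝ) ^ (-(k * d) : ℝ) := by
        rw [← mul_assoc, mul_pow, inv_pow, ← pow_mul, Real.rpow_neg (by norm_num),
          ← Nat.cast_mul, Real.rpow_natCast]
        norm_num
      -- As `l.length * p ≤ d`, the exponent `-k (d - l.length * p)` only grows when `k` is replaced
      -- by the smaller `N`.
      have e3 : (4 : ℝ) ^ (k * (l.length * p) : ℝ) * (4 : ℝ) ^ (-(k * d) : ℝ) ≤
          (4 : ℝ) ^ (-(N * (d - l.length * p))) := by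
        rw [← Real.rpow_add (by norm_num)]
        refine Real.rpow_le_rpow_of_exponent_le (by norm_num) ?_
        have : (N : ℝ) ≤ k := by exact_mod_cast hk.le
        nlinarith
      rw [e1, e2]
      calc _ = (M ^ p * 4 ^ d) * (((N : ℝ)⁻¹) ^ p *
            ((4 : ℝ) ^ (k * (l.length * p) : ℝ) * (4 : ℝ) ^ (-(k * d) : ℝ))) := by ring
        _ ≤ _ := by gcongr
    refine (Finset.sum_le_card_nsmul _ _ _ hterm).trans ?_
    rw [Finset.card_product, Nat.card_Ioc, show 2 * N - N = N by omega, nsmul_eq_mul,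
      ← ENNReal.ofReal_natCast, ← ENNReal.ofReal_mul (by positivity)]
    refine ENNReal.ofReal_le_ofReal (le_of_eq ?_)
    push_cast
    ring

end Bounds

/-- The expression is `N ^ (1 - p) * 4 ^ (-N s)` for `N > 0`. Both factors are at most `1`, and one
of them tends to `0`: the first if `p > 1`, the second if `s > 0`. -/
theorem tendsto_mul_inv_rpow_mul_rpow {p s : ℝ} (hp : 1 ≤ p) (hs : 0 ≤ s) (h : 1 < p ∨ 0 < s) :
    Tendsto (fun N : ℕ => (N : ℝ) * ((N : ℝ)⁻¹) ^ p * (4 : ℝ) ^ (-(N * s))) atTop (nhds 0) := by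
  have e : ∀ N : ℕ, 0 < N → (N : ℝ) * ((N : ℝ)⁻¹) ^ p = (N : ℝ) ^ (-(p - 1)) := by
    intro N hN
    have hN' : (0 : ℝ) < N := by positivity
    rw [Real.inv_rpow hN'.le, ← Real.rpow_neg hN'.le, neg_sub, sub_eq_add_neg,
      Real.rpow_add hN', Real.rpow_one]
  have hle1 : ∀ N : ℕ, 0 < N → (N : ℝ) ^ (-(p - 1)) ≤ 1 := fun N hN =>
    Real.rpow_le_one_of_one_le_of_nonpos (by exact_mod_cast hN) (by linarith)
  have hle2 : ∀ N : ℕ, (4 : ℝ) ^ (-(N * s)) ≤ 1 := fun N =>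
    Real.rpow_le_one_of_one_le_of_nonpos (by norm_num) (by
      have : (0 : ℝ) ≤ N * s := by positivity
      linarith)
  rcases h with h | h
  · refine squeeze_zero' (Eventually.of_forall fun N => by positivity) ?_
      ((tendsto_rpow_neg_atTop (sub_pos.2 h)).comp tendsto_natCast_atTop_atTop)
    filter_upwards [eventually_gt_atTop 0] with N hN
    rw [e N hN]
    exact mul_le_of_le_one_right (by positivity) (hle2 N)
  · refine squeeze_zero' (Eventually.of_forall fun N => by positivity) ?_
      (tendsto_pow_atTop_nhds_zero_of_lt_one (r := (4 : ℝ) ^ (-s)) (by positivity)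
        (Real.rpow_lt_one_of_one_lt_of_neg (by norm_num) (by linarith)))
    filter_upwards [eventually_gt_atTop 0] with N hN
    rw [e N hN, ← Real.rpow_natCast, ← Real.rpow_mul (by norm_num), neg_mul, mul_comm s]
    exact mul_le_of_le_one_left (by positivity) (hle1 N hN)

theorem tendsto_lintegral_listDeriv_punctured {η : (Fin d → ℝ) → ℝ} (hη : IsPlateau η)
    (X : Finset (Fin d → ℝ)) {p : ℝ} (hp : 1 ≤ p) {l : List (Fin d)} (hl : l ≠ [])
    (hlp : l.length * p ≤ d) (h : 1 < p ∨ l.length * p < d) :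
    Tendsto (fun N => ∫⁻ x, ‖listDeriv l (punctured η X N) x‖ₑ ^ p) atTop (nhds 0) := by
  obtain ⟨M, hM0, hM⟩ := hη.exists_listDeriv_bound l
  have h1 := (tendsto_mul_inv_rpow_mul_rpow hp (sub_nonneg.2 hlp)
    (h.imp id sub_pos.2)).const_mul (X.card * (M ^ p * 4 ^ d))
  have h2 := (ENNReal.continuous_ofReal.tendsto _).comp h1
  rw [mul_zero, ENNReal.ofReal_zero] at h2
  refine tendsto_of_tendsto_of_tendsto_of_le_of_le' tendsto_const_nhds h2
    (Eventually.of_forall fun _ => zero_le) ?_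
  filter_upwards [eventually_isSeparatedAt X] with N hN
  exact lintegral_listDeriv_punctured_le hη hN (by linarith) hl hlp hM0 hM

end Punctured

/-! Integration in Sobolev spaces that are not embedded into the continuous functions -/

section Integration

open scoped ContDiff
open Filter

variable {d : ℕ}

theorem order_mul_le_of_not_embeddingCondition {r : ℕ} (hd : 1 ≤ d) {p : ℝ} (hp : 1 ≤ p)
    (hE : ¬ EmbeddingCondition r d p) {m : ℕ} (hm : m ≤ r) :
    m * p ≤ d ∧ (1 < p ∨ m * p < d) := by
  have hd' : (0 : ℝ) < d := by exact_mod_cast hd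
  have hm' : (m : ℝ) ≤ r := by exact_mod_cast hm
  simp only [EmbeddingCondition, not_or, not_and, not_le, not_lt] at hE
  rcases hp.eq_or_lt with rfl | h
  · have := hE.1 rfl
    rw [div_lt_one hd'] at this
    rw [mul_one]
    exact ⟨by linarith, Or.inr (by linarith)⟩
  · have := hE.2 h
    rw [div_le_div_iff₀ hd' (by linarith), one_mul] at this
    exact ⟨(mul_le_mul_of_nonneg_right hm' (by linarith)).trans this, Or.inl h⟩

theorem volume_cube (d : ℕ) : volume (cube d) = 1 := by
  rw [Real.volume_Icc_pi]
  simp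

theorem volume_interior_cube_le (d : ℕ) : volume (interior (cube d)) ≤ 1 :=
  (measure_mono interior_subset).trans (volume_cube d).le

theorem eLpNorm_rpow_eq_lintegral {X : Type*} [MeasurableSpace X] (μ : Measure X) {p : ℝ}
    (hp : 0 < p) (f : X → ℝ) :
    eLpNorm f (ENNReal.ofReal p) μ ^ p = ∫⁻ x, ‖f x‖ₑ ^ p ∂μ := by
  rw [eLpNorm_eq_lintegral_rpow_enorm_toReal (by simpa using hp) (by simp),
    ENNReal.toReal_ofReal hp.le, ← ENNReal.rpow_mul, one_div, inv_mul_cancel₀ hp.ne',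
    ENNReal.rpow_one]

theorem directions_eq_nil_iff {α : Fin d → ℕ} : directions α = [] ↔ α = 0 := by
  rw [← List.length_eq_zero_iff, length_directions, Finset.sum_eq_zero_iff]
  simp [funext_iff]

theorem eventually_sobolevENorm_punctured_le {r : ℕ} (hd : 1 ≤ d) {p : ℝ} (hp : 1 ≤ p)
    (hE : ¬ EmbeddingCondition r d p) {η : (Fin d → ℝ) → ℝ} (hη : IsPlateau η)
    (X : Finset (Fin d → ℝ)) :
    ∀ᶠ N in atTop, ∀ u : (Fin d → ℝ) → ℝ, EqOn u (punctured η X N) (interior (cube d)) →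
      sobolevENorm r p (interior (cube d)) u ≤ 1 := by
  have hp0 : 0 < p := by linarith
  have h0 : (0 : Fin d → ℕ) ∈ multiIndices d r := mem_multiIndices.2 (by simp)
  have hlim : Tendsto (fun N => ∑ α ∈ (multiIndices d r).erase 0,
      ∫⁻ x, ‖listDeriv (directions α).reverse (punctured η X N) x‖ₑ ^ p) atTop (nhds 0) := by
    rw [← Finset.sum_const_zero (ι := Fin d → ℕ) (M := ℝ≥0∞) (s := (multiIndices d r).erase 0)]
    refine tendsto_finsetSum _ fun α hα => ?_
    obtain ⟨hα0, hα⟩ := Finset.mem_erase.1 hα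
    have hlen : (directions α).reverse.length ≤ r := by
      rw [List.length_reverse, length_directions]
      exact mem_multiIndices.1 hα
    obtain ⟨h1, h2⟩ := order_mul_le_of_not_embeddingCondition hd hp hE hlen
    exact tendsto_lintegral_listDeriv_punctured hη X hp
      (by simpa [directions_eq_nil_iff] using hα0) h1 h2
  filter_upwards [hlim.eventually_le_const (u := 2⁻¹) (by simp), eventually_isSeparatedAt X,
    eventually_gt_atTop 0] with N hN hX hN0 u hu
  refine (sobolevENorm_le_of_contDiff r p isOpen_interior (contDiff_punctured hη X N) hu).trans ?_
  refine ENNReal.rpow_le_one ?_ (by positivity)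
  simp only [eLpNorm_rpow_eq_lintegral _ hp0]
  rw [← Finset.add_sum_erase _ _ h0, ← ENNReal.inv_two_add_inv_two]
  -- The bound `1` is shared equally: one half for the function itself, whose values lie in `[0,
  -- 1/2]`, and one half for all derivatives of positive order.
  refine add_le_add ?_ ((Finset.sum_le_sum fun α _ => setLIntegral_le_lintegral _ _).trans hN)
  rw [directions_eq_nil_iff.2 rfl]
  calc ∫⁻ x in interior (cube d), ‖listDeriv [] (punctured η X N) x‖ₑ ^ p
      ≤ ∫⁻ _ in interior (cube d), 2⁻¹ := by
        refine lintegral_mono fun x => ?_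
        obtain ⟨hx0, hx1⟩ := punctured_mem_Icc hη hX hN0 x
        have hle : ‖listDeriv [] (punctured η X N) x‖ₑ ≤ 2⁻¹ := by
          change ‖punctured η X N x‖ₑ ≤ 2⁻¹
          rw [Real.enorm_of_nonneg hx0]
          refine (ENNReal.ofReal_le_ofReal hx1).trans ?_
          rw [one_div, ENNReal.ofReal_inv_of_pos (by norm_num)]
          simp
        calc _ ≤ ‖listDeriv [] (punctured η X N) x‖ₑ ^ (1 : ℝ) :=
              ENNReal.rpow_le_rpow_of_exponent_ge (hle.trans (by simp)) hp
          _ ≤ _ := by rwa [ENNReal.rpow_one]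
    _ ≤ 2⁻¹ := by
        rw [lintegral_const, Measure.restrict_apply_univ]
        exact mul_le_of_le_one_right (zero_le) (volume_interior_cube_le d)

/-- The function is nonnegative and equals `1/2` off small balls around `X`, which eventually cover
at most half of the cube. -/
theorem eventually_quarter_le_integral_punctured (hd : 1 ≤ d) {η : (Fin d → ℝ) → ℝ}
    (hη : IsPlateau η) (X : Finset (Fin d → ℝ)) :
    ∀ᶠ N in atTop, 1 / 4 ≤ ∫ x in cube d, punctured η X N x := by
  have hlim : Tendsto (fun N : ℕ => (X.card : ℝ) * (2 * (2 * ((4 : ℝ) ^ N)⁻¹)) ^ d) atTop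
      (nhds 0) := by
    have := (((tendsto_inv_four_pow.const_mul 2).const_mul 2).pow d).const_mul (X.card : ℝ)
    simpa [show d ≠ 0 by omega] using this
  filter_upwards [hlim.eventually_le_const (u := 1 / 2) (by norm_num), eventually_isSeparatedAt X,
    eventually_gt_atTop 0] with N hN hX hN0
  set E : Set (Fin d → ℝ) := ⋃ a ∈ X, Metric.closedBall a (2 * ((4 : ℝ) ^ N)⁻¹) with hE
  have hEm : MeasurableSet E := X.measurableSet_biUnion fun a _ => measurableSet_closedBall
  set ν := volume.restrict (cube d) with hν
  have : IsProbabilityMeasure ν := ⟨by rw [hν, Measure.restrict_apply_univ, volume_cube]⟩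
  have hEle : ν.real E ≤ 1 / 2 := by
    refine ENNReal.toReal_le_of_le_ofReal (by norm_num) ?_
    calc ν E ≤ volume E := Measure.restrict_apply_le _ _
      _ ≤ ∑ a ∈ X, volume (Metric.closedBall a (2 * ((4 : ℝ) ^ N)⁻¹)) :=
          measure_biUnion_finset_le _ _
      _ = ENNReal.ofReal ((X.card : ℝ) * (2 * (2 * ((4 : ℝ) ^ N)⁻¹)) ^ d) := by
          rw [Finset.sum_congr rfl fun a _ => Real.volume_pi_closedBall a (by positivity),
            Fintype.card_fin, Finset.sum_const, nsmul_eq_mul, ENNReal.ofReal_mul (by positivity),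
            ENNReal.ofReal_natCast]
      _ ≤ _ := ENNReal.ofReal_le_ofReal hN
  have hcompl : ν.real Eᶜ = 1 - ν.real E := probReal_compl_eq_one_sub hEm
  have hint : Integrable (punctured η X N) ν :=
    (contDiff_punctured hη X N).continuous.continuousOn.integrableOn_compact isCompact_Icc
  calc (1 / 4 : ℝ) ≤ ν.real Eᶜ * (1 / 2) := by linarith
    _ = ∫ x, Eᶜ.indicator (fun _ => (1 / 2 : ℝ)) x ∂ν := by
        rw [integral_indicator_const _ hEm.compl, smul_eq_mul]
    _ ≤ ∫ x, punctured η X N x ∂ν := by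
        refine integral_mono ((integrable_const _).indicator hEm.compl) hint fun x => ?_
        by_cases hx : x ∈ Eᶜ
        · rw [indicator_of_mem hx, punctured_eq_half hη]
          intro a ha
          by_contra! h
          exact hx (mem_biUnion ha (by rwa [Metric.mem_closedBall, dist_eq_norm]))
        · rw [indicator_of_notMem hx]
          exact (punctured_mem_Icc hη hX hN0 x).1

/-- If the embedding condition fails, then the unit ball contains continuous functions that vanish
at prescribed points and have an integral of at least `1 / 4`. -/
theorem exists_mem_sobolevBall_forall_eq_zero {r : ℕ} (hd : 1 ≤ d) {p : ℝ} (hp : 1 ≤ p)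
    (hE : ¬ EmbeddingCondition r d p) (X : Finset (cube d)) :
    ∃ f ∈ sobolevBall r d p, (∀ x ∈ X, f x = 0) ∧ 1 / 4 ≤ ∫ x in cube d, extendZero f x := by
  obtain ⟨η, hη⟩ := exists_isPlateau d
  set Y : Finset (Fin d → ℝ) := X.map (Function.Embedding.subtype _) with hY
  obtain ⟨N, hN1, hN2, hX, hN0⟩ := ((eventually_sobolevENorm_punctured_le hd hp hE hη Y).and
    ((eventually_quarter_le_integral_punctured hd hη Y).and
      ((eventually_isSeparatedAt Y).and (eventually_gt_atTop 0)))).exists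
  let f : C(cube d, ℝ) :=
    ⟨fun x => punctured η Y N x, (contDiff_punctured hη Y N).continuous.comp continuous_subtype_val⟩
  have hf : EqOn (extendZero f) (punctured η Y N) (cube d) := fun x hx => by
    simp only [extendZero, dif_pos hx]
    rfl
  refine ⟨f, hN1 _ (hf.mono interior_subset), fun x hx => ?_, ?_⟩
  · exact punctured_eq_zero hη hX hN0 (Finset.mem_map_of_mem _ hx)
  · rwa [setIntegral_congr_fun measurableSet_Icc hf]

end Integration

end RestrictedMC

end

theorem corollary1 (r d : ℕ) (hr : 1 ≤ r) (hd : 1 ≤ d) (p : ℝ) (hp : 1 ≤ p)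
    (hE : ¬ RestrictedMC.EmbeddingCondition r d p)
    {Ω K' : Type*} [MeasurableSpace Ω] (R : RestrictedMC.AccessRestriction Ω K')
    (hR : R.IsFinite) :
    ∃ c : ℝ, 0 < c ∧ ∀ n k : ℕ,
      ENNReal.ofReal c ≤
        RestrictedMC.minRanError (RestrictedMC.sobolevIntegration r d p hp) R n k := by
  -- `1 / 16` is `δ / 4` for `δ = 1 / 4`, the integral that separates the punctured function from
  -- zero.
  refine ⟨1 / 16, by norm_num, fun n k => ?_⟩
  have hc : ENNReal.ofReal (1 / 16) = ENNReal.ofReal (1 / 4) / 4 := by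
    rw [← ENNReal.ofReal_ofNat 4, ← ENNReal.ofReal_div_of_pos (by norm_num)]
    norm_num
  rw [hc]
  refine RestrictedMC.le_minRanError_of_finite hR
    ⟨0, RestrictedMC.zero_mem_sobolevBall r d hp⟩ (fun T hT hTΛ => ?_) n k
  classical
  have : Nonempty (RestrictedMC.cube d) := ⟨⟨0, by simp⟩⟩
  have hpoint : ∀ l ∈ T, ∃ x : RestrictedMC.cube d,
      ∀ f : RestrictedMC.sobolevBall r d p, l f = f.1 x := by
    intro l hl
    obtain ⟨x, rfl⟩ := hTΛ hl
    exact ⟨x, fun f => rfl⟩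
  choose! x hx using hpoint
  obtain ⟨f, hf, hfX, hfI⟩ :=
    RestrictedMC.exists_mem_sobolevBall_forall_eq_zero hd hp hE (hT.toFinset.image x)
  refine ⟨⟨f, hf⟩, fun l hl => ?_, ?_⟩
  · rw [hx l hl, hx l hl, hfX (x l) (Finset.mem_image_of_mem x (hT.mem_toFinset.2 hl))]
    rfl
  · have h0 : ∫ x in RestrictedMC.cube d, RestrictedMC.extendZero (0 : C(RestrictedMC.cube d, ℝ)) x
        = 0 := by
      simp [RestrictedMC.extendZero]
    have hS : (RestrictedMC.sobolevIntegration r d p hp).S ⟨f, hf⟩ -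
        (RestrictedMC.sobolevIntegration r d p hp).S
          ⟨0, RestrictedMC.zero_mem_sobolevBall r d hp⟩ =
        ∫ x in RestrictedMC.cube d, RestrictedMC.extendZero f x := by
      simp only [RestrictedMC.sobolevIntegration, h0, sub_zero]
    rw [hS, Real.enorm_of_nonneg (by linarith)]
    exact ENNReal.ofReal_le_ofReal hfI
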